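/- Let $\mathbf{S}_1$ be the monoid presented by $$\langle a,b,t,x,y \mid ab\Rightarrow 1,\ xa\Rightarrow atx,\ xt\Rightarrow tx,\ xb\Rightarrow bx,\ xy\Rightarrow 1\rangle .$$ Then $\mathbf{S}_1$ is not of finite derivation type. That is, there is no finite presentation $\Sigma$ of $\mathbf{S}_1$ (finite set $\Sigma_1$ of generators and finite set $\Sigma_2$ of relations $\alpha : u\Rightarrow v$ between words of the free monoid $\Sigma_1^*$) whose free $(2,1)$-category $\Sigma^\top$ admits a finite homotopy basis. Here $\Sigma^\top$ is the $(2,1)$-category with one 0-cell whose 1-cells are the words of $\Sigma_1^*$ and whose 2-cells are the zigzags of rewriting steps $w\alpha w'$ ($\alpha\in\Sigma_2$, $w,w'\in\Sigma_1^*$), modulo cancellation of a step against its formal inverse and modulo the exchange relations, which identify the two ways of applying two relations to disjoint factors of a word. A homotopy basis of $\Sigma^\top$ is a set $\Gamma$ of pairs of parallel 2-cells such that the smallest equivalence relation on parallel 2-cells that contains $\Gamma$ and is compatible with the compositions, i.e. such that $f\equiv g$ implies $w\star_0(h\star_1 f\star_1 k)\star_0 w'\equiv w\star_0(h\star_1 g\star_1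 k)\star_0 w'$, identifies all parallel 2-cells. -/

import Mathlib

open CategoryTheory

/-- A 2-polygraph with exactly one 0-cell, i.e. a presentation of a monoid by generators and
(oriented) relations: a set `Gen` of generating 1-cells and a cellular extension `Rel` of the free
monoid over `Gen`, each generating 2-cell `α` having a source and a target word. -/
structure TwoPolygraph where
  /-- The generating 1-cells. -/
  Gen : Type
  /-- The generating 2-cells. -/
  Rel : Type
  /-- The source of a generating 2-cell. -/
  src : Rel → FreeMonoid Gen
  /-- The target of a generating 2-cell. -/
  tgt : Rel → FreeMonoid Gen

namespace TwoPolygraph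

variable (S : TwoPolygraph)

/-- A 2-polygraph is finite if it has finitely many cells in every dimension. -/
def IsFinite : Prop := Finite S.Gen ∧ Finite S.Rel

/-- The monoid presented by a 2-polygraph: the quotient of the free monoid of words by the
congruence generated by the relations. -/
abbrev Presented : Type :=
  PresentedMonoid (fun u v : FreeMonoid S.Gen => ∃ α : S.Rel, u = S.src α ∧ v = S.tgt α)

/-- `S` is a presentation of the monoid `M`. -/
def Presents (M : Type*) [Monoid M] : Prop := Nonempty (S.Presented ≃* M)

/-- The 1-cells: words over the generators. -/
def Word : Type := FreeMonoid S.Gen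

instance : Monoid S.Word := inferInstanceAs (Monoid (FreeMonoid S.Gen))

/-- The source of a generating 2-cell, as a 1-cell. -/
def lhs (α : S.Rel) : S.Word := S.src α

/-- The target of a generating 2-cell, as a 1-cell. -/
def rhs (α : S.Rel) : S.Word := S.tgt α

/-- A rewriting step from the word `p` to the word `q`: a whiskered generating 2-cell
`left α right`, with `p = left (lhs α) right` and `q = left (rhs α) right`. -/
structure Step (p q : S.Word) where
  /-- The left context. -/
  left : S.Word
  /-- The generating 2-cell that is applied. -/
  rel : S.Rel
  /-- The right context. -/
  right : S.Word
  src_eq : p = left * S.lhs rel * right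
  tgt_eq : q = left * S.rhs rel * right

/-- The quiver of words and rewriting steps. -/
instance : Quiver S.Word where
  Hom p q := S.Step p q

/-- A rewriting step as an arrow of the free groupoid over the quiver of rewriting steps, that is,
of the groupoid of zigzags of rewriting steps modulo cancellation of a step against its formal
inverse. -/
def zigzag {p q : S.Word} (s : S.Step p q) :
    (Quiver.FreeGroupoid.of S.Word).obj p ⟶ (Quiver.FreeGroupoid.of S.Word).obj q :=
  (Quiver.FreeGroupoid.of S.Word).map s

/-- The exchange relations: for generating 2-cells `α`, `β` and words `l`, `m`, `r`, applying `α`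
and then `β` in the word `l (lhs α) m (lhs β) r` is identified with applying `β` and then `α`.
(The exchange relations that involve formal inverses of generating 2-cells follow from these in a
groupoid.) -/
inductive Exchange : HomRel (Quiver.FreeGroupoid S.Word)
  | mk (l m r : S.Word) (α β : S.Rel) {p q₁ q₂ q : S.Word}
      (hp : p = l * S.lhs α * m * S.lhs β * r) (hq₁ : q₁ = l * S.rhs α * m * S.lhs β * r)
      (hq₂ : q₂ = l * S.lhs α * m * S.rhs β * r) (hq : q = l * S.rhs α * m * S.rhs β * r) :
      Exchange
        (S.zigzag (p := p) (q := q₁) ⟨l, α, m * S.lhs β * r,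
            by simp only [hp, mul_assoc], by simp only [hq₁, mul_assoc]⟩ ≫
          S.zigzag (p := q₁) (q := q) ⟨l * S.rhs α * m, β, r, hq₁, hq⟩)
        (S.zigzag (p := p) (q := q₂) ⟨l * S.lhs α * m, β, r, hp, hq₂⟩ ≫
          S.zigzag (p := q₂) (q := q) ⟨l, α, m * S.rhs β * r,
            by simp only [hq₂, mul_assoc], by simp only [hq, mul_assoc]⟩)

/-- The hom-groupoid of the free (2,1)-category over `S` (which has a single 0-cell): its objects
are the 1-cells, i.e. the words, and its arrows are the 2-cells. The 1-composition `⋆₁` of 2-cells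
is the composition of this groupoid. -/
abbrev FreeTwoOne : Type := CategoryTheory.Quotient S.Exchange

/-- A word, as an object of the hom-groupoid of the free (2,1)-category. -/
def cell (u : S.Word) : S.FreeTwoOne := ⟨(Quiver.FreeGroupoid.of S.Word).obj u⟩

/-- The 2-cells from `u` to `v` of the free (2,1)-category over `S`. -/
abbrev TwoCell (u v : S.Word) : Type := S.cell u ⟶ S.cell v

/-- The rewriting step `w s w'` obtained by whiskering the rewriting step `s`. -/
def Step.whisker {S : TwoPolygraph} {p q : S.Word} (w : S.Word) (s : S.Step p q) (w' : S.Word) :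
    S.Step (w * p * w') (w * q * w') where
  left := w * s.left
  rel := s.rel
  right := s.right * w'
  src_eq := (congrArg (fun u => w * u * w') s.src_eq).trans (by simp only [mul_assoc])
  tgt_eq := (congrArg (fun u => w * u * w') s.tgt_eq).trans (by simp only [mul_assoc])

/-- Whiskering of rewriting steps by the words `w` (on the left) and `w'` (on the right), as a
morphism of quivers. -/
def whiskerStep (w w' : S.Word) : S.Word ⥤q S.Word where
  obj u := w * u * w'
  map s := Step.whisker w s w'

lemma map_zigzag_comp (w w' : S.Word) {p q r : S.Word} (s : S.Step p q) (t : S.Step q r) :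
    (Quiver.freeGroupoidFunctor (S.whiskerStep w w')).map (S.zigzag s ≫ S.zigzag t) =
      S.zigzag (Step.whisker w s w') ≫ S.zigzag (Step.whisker w t w') := rfl

lemma zigzag_congr {p q : S.Word} {s s' : S.Step p q} (hl : s.left = s'.left)
    (hα : s.rel = s'.rel) (hr : s.right = s'.right) : S.zigzag s = S.zigzag s' := by
  obtain ⟨l, α, r, h, k⟩ := s
  obtain ⟨l', α', r', h', k'⟩ := s'
  obtain rfl : l = l' := hl
  obtain rfl : α = α' := hα
  obtain rfl : r = r' := hr
  rfl

lemma whisker_exchange (w w' : S.Word) (x y : Quiver.FreeGroupoid S.Word) (f g : x ⟶ y)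
    (h : S.Exchange f g) :
    (Quiver.freeGroupoidFunctor (S.whiskerStep w w') ⋙ CategoryTheory.Quotient.functor S.Exchange).map f =
      (Quiver.freeGroupoidFunctor (S.whiskerStep w w') ⋙ CategoryTheory.Quotient.functor S.Exchange).map g := by
  obtain ⟨l, m, r, α, β, hp, hq₁, hq₂, hq⟩ := h
  have key := Exchange.mk (S := S) (w * l) m (r * w') α β
    (congrArg (fun u => w * u * w') hp |>.trans (by simp only [mul_assoc]))
    (congrArg (fun u => w * u * w') hq₁ |>.trans (by simp only [mul_assoc]))
    (congrArg (fun u => w * u * w') hq₂ |>.trans (by simp only [mul_assoc]))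
    (congrArg (fun u => w * u * w') hq |>.trans (by simp only [mul_assoc]))
  refine (congrArg _ (Eq.trans (S.map_zigzag_comp w w' _ _) ?_)).trans
    ((CategoryTheory.Quotient.sound S.Exchange key).trans
      (congrArg _ (Eq.trans (S.map_zigzag_comp w w' _ _) ?_)).symm)
  all_goals
    refine congrArg₂ _ (S.zigzag_congr ?_ ?_ ?_) (S.zigzag_congr ?_ ?_ ?_) <;>
      simp only [Step.whisker, mul_assoc]

/-- The two-sided whiskering `f ↦ w ⋆₀ f ⋆₀ w'` of 2-cells, as an endofunctor of the hom-groupoid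
of the free (2,1)-category. -/
def whiskering (w w' : S.Word) : S.FreeTwoOne ⥤ S.FreeTwoOne :=
  CategoryTheory.Quotient.lift S.Exchange
    (Quiver.freeGroupoidFunctor (S.whiskerStep w w') ⋙ CategoryTheory.Quotient.functor S.Exchange)
    (S.whisker_exchange w w')

/-- The whiskered 2-cell `w ⋆₀ f ⋆₀ w'`. -/
def whisker (w : S.Word) {u v : S.Word} (f : S.TwoCell u v) (w' : S.Word) :
    S.TwoCell (w * u * w') (w * v * w') :=
  (S.whiskering w w').map f

/-- A cellular extension of the free (2,1)-category over `S`: a set of 3-cells, each with a source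
and a target that are parallel 2-cells. -/
structure CellularExtension where
  /-- The 3-cells. -/
  Cell : Type
  /-- The common 1-source of the boundary of a 3-cell. -/
  dom : Cell → S.Word
  /-- The common 1-target of the boundary of a 3-cell. -/
  cod : Cell → S.Word
  /-- The source 2-cell. -/
  src : (γ : Cell) → S.TwoCell (dom γ) (cod γ)
  /-- The target 2-cell. -/
  tgt : (γ : Cell) → S.TwoCell (dom γ) (cod γ)

variable {S}

/-- The congruence generated by a cellular extension `Γ`: the smallest equivalence relation on
parallel 2-cells that identifies the source and the target of every 3-cell of `Γ` and that is
compatible with both compositions, i.e. with every context `w ⋆₀ (h ⋆₁ - ⋆₁ k) ⋆₀ w'`. -/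
inductive CellularExtension.Congr (Γ : CellularExtension S) :
    {u v : S.Word} → S.TwoCell u v → S.TwoCell u v → Prop
  | of (γ : Γ.Cell) : Γ.Congr (Γ.src γ) (Γ.tgt γ)
  | refl {u v : S.Word} (f : S.TwoCell u v) : Γ.Congr f f
  | symm {u v : S.Word} {f g : S.TwoCell u v} : Γ.Congr f g → Γ.Congr g f
  | trans {u v : S.Word} {f g h : S.TwoCell u v} : Γ.Congr f g → Γ.Congr g h → Γ.Congr f h
  | comp {u u' v' v : S.Word} (h : S.TwoCell u u') {f g : S.TwoCell u' v'} (k : S.TwoCell v' v) :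
      Γ.Congr f g → Γ.Congr (h ≫ f ≫ k) (h ≫ g ≫ k)
  | whisker {u v : S.Word} (w : S.Word) {f g : S.TwoCell u v} (w' : S.Word) :
      Γ.Congr f g → Γ.Congr (S.whisker w f w') (S.whisker w g w')

/-- `Γ` is a homotopy basis if all parallel 2-cells are identified by the congruence it
generates. -/
def CellularExtension.IsHomotopyBasis (Γ : CellularExtension S) : Prop :=
  ∀ (u v : S.Word) (f g : S.TwoCell u v), Γ.Congr f g

variable (S)

/-- A 2-polygraph is of finite derivation type if it is finite and its free (2,1)-category admits
a finite homotopy basis. -/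
def IsOfFiniteDerivationType : Prop :=
  S.IsFinite ∧ ∃ Γ : CellularExtension S, Finite Γ.Cell ∧ Γ.IsHomotopyBasis

end TwoPolygraph

/-- A monoid is of finite derivation type if it admits a finite coherent presentation, i.e. a finite
presentation together with a finite homotopy basis of its free (2,1)-category. (As all the sets
of cells are finite here, it is no restriction that they are taken in `Type`.) -/
def Monoid.IsOfFiniteDerivationType (M : Type*) [Monoid M] : Prop :=
  ∃ S : TwoPolygraph, S.Presents M ∧ S.IsOfFiniteDerivationType

/-- The five generators of Squier's monoid. -/
inductive SquierGen
  | a | b | t | x | y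

/-- The five relations of Squier's monoid. -/
inductive SquierRel
  | α | β | γ | δ | ε

/-- Squier's finite presentation
`⟨a, b, t, x, y | ab ⇒ 1, xa ⇒ atx, xt ⇒ tx, xb ⇒ bx, xy ⇒ 1⟩`. -/
def squierPolygraph : TwoPolygraph where
  Gen := SquierGen
  Rel := SquierRel
  src
    | .α => .of .a * .of .b
    | .β => .of .x * .of .a
    | .γ => .of .x * .of .t
    | .δ => .of .x * .of .b
    | .ε => .of .x * .of .y
  tgt
    | .α => 1
    | .β => .of .a * .of .t * .of .x
    | .γ => .of .t * .of .x
    | .δ => .of .b * .of .x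
    | .ε => 1

/-- Squier's monoid `S₁`. -/
abbrev SquierMonoid : Type := squierPolygraph.Presented

/-! In `S₁` every word a tⁿ b equals 1: a tⁿ⁺¹ b x is linked to x a tⁿ b by β, γ, δ, and ε removes
the x. So for each n there are two 2-cells from a tⁿ⁺¹ b x to x: reduce a tⁿ⁺¹ b in place, or return
to x a tⁿ b and reduce a tⁿ b. No finite set of 3-cells accounts for all these pairs, and a Fox-type
derivative detects this.

The derivative sums, with signs, over the occurrences of α in a 2-cell, the images of their right
contexts in a ring where x ↦ X, y ↦ Y, a, b, t ↦ 1 and XY = 1 ≠ YX. On the two 2-cells it can be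
made Yⁿ and Yⁿ⁺¹X; the difference Yⁿ(1 - YX) is not killed by Xⁿ. Yet every difference over parallel
2-cells is killed by some power of X (`exists_fox_sub_mem_torsion`): modulo such elements Y acts as
an inverse of X, and the derivative has a potential, computed by a stack machine. The right ideals
{r | Xⁿ r = 0} increase with n, and finite derivation type, witnessed by any presentation, would put
all differences into one of them (`exists_forall_fox_sub_mem`). -/

namespace TwoPolygraph

/-! ### 2-cells of a free (2,1)-category and equality in the presented monoid -/

variable {S : TwoPolygraph}

/-- A rewriting step, as a 2-cell of the free (2,1)-category. -/
def stepCell {p q : S.Word} (s : S.Step p q) : S.TwoCell p q :=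
  (CategoryTheory.Quotient.functor S.Exchange).map (S.zigzag s)

/-- The generating 2-cell `α`, as a 2-cell of the free (2,1)-category. -/
def relCell (α : S.Rel) : S.TwoCell (S.lhs α) (S.rhs α) :=
  stepCell ⟨1, α, 1, by simp, by simp⟩

theorem twoCell_induction {P : ∀ {u v : S.Word}, S.TwoCell u v → Prop}
    (id : ∀ u : S.Word, P (𝟙 (S.cell u)))
    (comp : ∀ {u v w : S.Word} (f : S.TwoCell u v) (g : S.TwoCell v w), P f → P g → P (f ≫ g))
    (inv : ∀ {u v : S.Word} (f : S.TwoCell u v), P f → P (CategoryTheory.inv f))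
    (step : ∀ {u v : S.Word} (s : S.Step u v), P (stepCell s))
    {u v : S.Word} (f : S.TwoCell u v) : P f := by
  suffices h : ∀ {v : S.Word} (p : Quiver.Path (V := Quiver.Symmetrify S.Word) u v),
      P (u := u) (v := v) (Quot.mk _ (Quot.mk _ p)) by
    obtain ⟨f⟩ := f
    obtain ⟨p⟩ := f
    exact h p
  intro v p
  induction p with
  | nil => exact id u
  | cons p e ih =>
    rcases e with s | s
    · exact comp _ (stepCell s) ih (step s)
    · have h := comp _ _ ih (inv _ (step s))
      rw [← Groupoid.inv_eq_inv] at h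
      exact h

theorem whisker_stepCell {p q : S.Word} (w : S.Word) (s : S.Step p q) (w' : S.Word) :
    S.whisker w (stepCell s) w' = stepCell (Step.whisker w s w') := rfl

theorem whisker_comp {u v z : S.Word} (w : S.Word) (f : S.TwoCell u v) (g : S.TwoCell v z)
    (w' : S.Word) : S.whisker w (f ≫ g) w' = S.whisker w f w' ≫ S.whisker w g w' :=
  (S.whiskering w w').map_comp f g

theorem whisker_inv {u v : S.Word} (w : S.Word) (f : S.TwoCell u v) (w' : S.Word) :
    S.whisker w (CategoryTheory.inv f) w' = CategoryTheory.inv (S.whisker w f w') :=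
  (S.whiskering w w').map_inv f

variable (S) in
/-- The projection from words to the presented monoid. -/
def proj : S.Word →* S.Presented :=
  PresentedMonoid.mk (fun u v : FreeMonoid S.Gen => ∃ α : S.Rel, u = S.src α ∧ v = S.tgt α)

theorem proj_lhs (α : S.Rel) : S.proj (S.lhs α) = S.proj (S.rhs α) :=
  PresentedMonoid.mk_eq_mk_of_rel ⟨α, rfl, rfl⟩

theorem proj_surjective : Function.Surjective S.proj := PresentedMonoid.surjective_mk

/-- Words that represent the same element are connected by a 2-cell. -/
theorem nonempty_twoCell {u v : S.Word} (h : S.proj u = S.proj v) : Nonempty (S.TwoCell u v) := by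
  replace h : ConGen.Rel _ u v := PresentedMonoid.mk_eq_mk_iff.1 h
  induction h with
  | of x y h =>
    obtain ⟨α, rfl, rfl⟩ := h
    exact ⟨relCell α⟩
  | refl x => exact ⟨𝟙 (S.cell x)⟩
  | symm _ ih => exact ih.map fun f => CategoryTheory.inv f
  | trans _ _ ih₁ ih₂ => exact ih₁.elim fun f => ih₂.map fun g => f ≫ g
  | @mul u v w z _ _ ih₁ ih₂ =>
    obtain ⟨f⟩ := ih₁
    obtain ⟨g⟩ := ih₂
    have a : S.TwoCell (u * w) (v * w) := by
      simpa only [one_mul] using S.whisker (u := u) (v := v) (1 : S.Word) f w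
    have b : S.TwoCell (v * w) (v * z) := by
      simpa only [mul_one] using S.whisker (u := w) (v := z) v g (1 : S.Word)
    exact ⟨a ≫ b⟩

/-! ### Fox-type derivatives of 2-cells -/

variable (S) in
/-- The data of a right Fox-type derivative on 2-cells, with values in a ring `R`: a
representation of the presented monoid in `R` and a value for each relation. -/
structure FoxData (R : Type*) [Ring R] where
  /-- The representation. -/
  hom : S.Word →* R
  hom_lhs : ∀ α, hom (S.lhs α) = hom (S.rhs α)
  /-- The values of the generating 2-cells. -/
  val : S.Rel → R

namespace FoxData

variable {R : Type*} [Ring R] (C : S.FoxData R)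

/-- The derivative on rewriting steps. -/
def stepMap : S.Word ⥤q SingleObj (Multiplicative R) where
  obj _ := SingleObj.star _
  map s := Multiplicative.ofAdd (C.val s.rel * C.hom s.right)

theorem lift_stepMap_zigzag {p q : S.Word} (s : S.Step p q) :
    (Quiver.FreeGroupoid.lift C.stepMap).map (S.zigzag s) = C.stepMap.map s :=
  Category.id_comp _

/-- The derivative, as a functor. -/
def functor : S.FreeTwoOne ⥤ SingleObj (Multiplicative R) :=
  CategoryTheory.Quotient.lift S.Exchange (Quiver.FreeGroupoid.lift C.stepMap) <| by
    rintro _ _ _ _ ⟨l, m, r, α, β, hp, hq₁, hq₂, hq⟩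
    simp only [Functor.map_comp, lift_stepMap_zigzag]
    change (Multiplicative.ofAdd (C.val β * C.hom r) *
        Multiplicative.ofAdd (C.val α * C.hom (m * S.lhs β * r)) : Multiplicative R) =
      Multiplicative.ofAdd (C.val α * C.hom (m * S.rhs β * r)) *
        Multiplicative.ofAdd (C.val β * C.hom r)
    -- Addition in `R` is commutative and left contexts are ignored; only the right context of `α`
    -- changes, from `lhs β` to `rhs β`, which `hom` identifies.
    rw [mul_comm, C.hom.map_mul, C.hom.map_mul, C.hom.map_mul (m * _), C.hom.map_mul m, C.hom_lhs]

/-- The derivative of a 2-cell. -/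
def fox {u v : S.Word} (f : S.TwoCell u v) : R := Multiplicative.toAdd (C.functor.map f)

@[simp] theorem fox_step {u v : S.Word} (s : S.Step u v) :
    C.fox (stepCell s) = C.val s.rel * C.hom s.right :=
  congrArg Multiplicative.toAdd (C.lift_stepMap_zigzag s)

@[simp] theorem fox_id (u : S.Word) : C.fox (𝟙 (S.cell u)) = 0 := by
  unfold fox
  rw [CategoryTheory.Functor.map_id]
  rfl

@[simp] theorem fox_comp {u v w : S.Word} (f : S.TwoCell u v) (g : S.TwoCell v w) :
    C.fox (f ≫ g) = C.fox f + C.fox g := by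
  unfold fox
  rw [Functor.map_comp, add_comm]
  rfl

@[simp] theorem fox_inv {u v : S.Word} (f : S.TwoCell u v) :
    C.fox (CategoryTheory.inv f) = - C.fox f := by
  rw [eq_neg_iff_add_eq_zero, ← fox_comp, IsIso.inv_hom_id, fox_id]

-- Only right contexts enter the value of a step. This one-sidedness is why right ideals are the
-- relevant submodules.
@[simp] theorem fox_whisker {u v : S.Word} (w : S.Word) (f : S.TwoCell u v) (w' : S.Word) :
    C.fox (S.whisker w f w') = C.fox f * C.hom w' := by
  induction f using twoCell_induction with
  | id u =>
    rw [fox_id, zero_mul, ← C.fox_id (w * u * w')]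
    exact congrArg _ ((S.whiskering w w').map_id _)
  | comp f g hf hg => rw [whisker_comp, fox_comp, fox_comp, hf, hg, add_mul]
  | inv f hf => rw [whisker_inv, fox_inv, fox_inv, hf, neg_mul]
  | step s =>
    rw [whisker_stepCell, fox_step, fox_step]
    exact (congrArg (C.val s.rel * ·) (C.hom.map_mul s.right w')).trans (mul_assoc _ _ _).symm

theorem hom_eq_of_twoCell {u v : S.Word} (f : S.TwoCell u v) : C.hom u = C.hom v := by
  induction f using twoCell_induction with
  | id u => rfl
  | comp f g hf hg => exact hf.trans hg
  | inv f hf => exact hf.symm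
  | step s =>
    obtain ⟨l, α, r, rfl, rfl⟩ := s
    simp only [map_mul, C.hom_lhs]

/-- `C.Attains u v d` means that `d` is the derivative of some 2-cell from `u` to `v`. -/
def Attains (u v : S.Word) (d : R) : Prop := ∃ f : S.TwoCell u v, C.fox f = d

variable {C}

theorem Attains.refl (u : S.Word) : C.Attains u u 0 := ⟨𝟙 _, C.fox_id u⟩

theorem Attains.trans {u v w : S.Word} {d e : R} (h : C.Attains u v d) (k : C.Attains v w e) :
    C.Attains u w (d + e) := by
  obtain ⟨f, rfl⟩ := h
  obtain ⟨g, rfl⟩ := k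
  exact ⟨f ≫ g, C.fox_comp f g⟩

theorem Attains.symm {u v : S.Word} {d : R} (h : C.Attains u v d) : C.Attains v u (-d) := by
  obtain ⟨f, rfl⟩ := h
  exact ⟨CategoryTheory.inv f, C.fox_inv f⟩

theorem Attains.whisker {u v : S.Word} {d : R} (h : C.Attains u v d) (w w' : S.Word) :
    C.Attains (w * u * w') (w * v * w') (d * C.hom w') := by
  obtain ⟨f, rfl⟩ := h
  exact ⟨S.whisker w f w', C.fox_whisker w f w'⟩

theorem Attains.mul_left {u v : S.Word} {d : R} (h : C.Attains u v d) (w : S.Word) :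
    C.Attains (w * u) (w * v) d := by
  simpa using h.whisker w 1

theorem Attains.mul_right {u v : S.Word} {d : R} (h : C.Attains u v d) (w : S.Word) :
    C.Attains (u * w) (v * w) (d * C.hom w) := by
  simpa using h.whisker 1 w

theorem Attains.rel (α : S.Rel) : C.Attains (S.lhs α) (S.rhs α) (C.val α) :=
  ⟨relCell α, by simp [relCell]⟩

/-- Derivatives are preserved by the 2-functors between free (2,1)-categories. -/
theorem Attains.map {T : TwoPolygraph} {D : T.FoxData R} (F : S.Word →* T.Word)
    (hF : ∀ w, D.hom (F w) = C.hom w) (hval : ∀ α, D.Attains (F (S.lhs α)) (F (S.rhs α)) (C.val α))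
    {u v : S.Word} (f : S.TwoCell u v) : D.Attains (F u) (F v) (C.fox f) := by
  induction f using twoCell_induction with
  | id u => simpa using Attains.refl (F u)
  | comp f g hf hg => simpa using hf.trans hg
  | inv f hf => simpa using hf.symm
  | step s =>
    obtain ⟨l, α, r, rfl, rfl⟩ := s
    rw [fox_step, ← hF]
    simpa only [map_mul] using (hval α).whisker (F l) (F r)

/-- Congruent 2-cells have the same derivative modulo every right ideal that contains the
derivatives of the 3-cells. -/
theorem fox_sub_mem_of_congr (C : S.FoxData R) {J : AddSubgroup R} (hJ : ∀ a ∈ J, ∀ r, a * r ∈ J)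
    {Γ : CellularExtension S} (h : ∀ γ, C.fox (Γ.src γ) - C.fox (Γ.tgt γ) ∈ J)
    {u v : S.Word} {f g : S.TwoCell u v} (hfg : Γ.Congr f g) : C.fox f - C.fox g ∈ J := by
  induction hfg with
  | of γ => exact h γ
  | refl f => simp
  | symm _ ih => simpa using J.neg_mem ih
  | trans _ _ ih₁ ih₂ => simpa using J.add_mem ih₁ ih₂
  | comp h k _ ih => simpa using ih
  | whisker w w' _ ih => simpa [sub_mul] using hJ _ ih (C.hom w')

end FoxData

end TwoPolygraph

/-! ### Independence of the presentation -/

namespace TwoPolygraph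

/-- A generating 1-cell, as a word. -/
def letter (T : TwoPolygraph) (z : T.Gen) : T.Word := FreeMonoid.of z

theorem exists_word_lift {S T : TwoPolygraph} (φ : S.Word →* T.Presented) :
    ∃ F : S.Word →* T.Word, ∀ w, T.proj (F w) = φ w := by
  choose F hF using fun z : S.Gen => proj_surjective (φ (FreeMonoid.of z))
  refine ⟨(FreeMonoid.lift F : FreeMonoid S.Gen →* T.Word), fun w => ?_⟩
  have h : T.proj.comp (FreeMonoid.lift F : FreeMonoid S.Gen →* T.Word) = φ :=
    FreeMonoid.hom_eq fun z => (congrArg T.proj (FreeMonoid.lift_eval_of F z)).trans (hF z)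
  exact DFunLike.congr_fun h w

namespace FoxData

variable {T : TwoPolygraph} {R : Type*} [Ring R] (C : T.FoxData R)

theorem hom_eq_of_proj_eq {u v : T.Word} (h : T.proj u = T.proj v) : C.hom u = C.hom v :=
  (nonempty_twoCell h).elim fun f => C.hom_eq_of_twoCell f

/-- The derivation on words with given values on the generators. -/
def derivation (σ : T.Gen → R) : T.Word → R := fun w =>
  List.rec (motive := fun _ => R) 0 (fun z w s => σ z * C.hom (FreeMonoid.ofList w) + s)
    (FreeMonoid.toList w)

theorem derivation_one (σ : T.Gen → R) : C.derivation σ 1 = 0 := rfl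

theorem derivation_of_mul (σ : T.Gen → R) (z : T.Gen) (w : T.Word) :
    C.derivation σ (T.letter z * w) = σ z * C.hom w + C.derivation σ w := rfl

theorem word_induction {P : T.Word → Prop} (one : P 1)
    (cons : ∀ (z : T.Gen) (w : T.Word), P w → P (T.letter z * w)) (w : T.Word) :
    P w :=
  FreeMonoid.inductionOn' w one cons

theorem derivation_mul (σ : T.Gen → R) (u v : T.Word) :
    C.derivation σ (u * v) = C.derivation σ u * C.hom v + C.derivation σ v := by
  induction u using word_induction with
  | one => simp [derivation_one]
  | cons z w ih =>
    rw [mul_assoc, derivation_of_mul, derivation_of_mul, ih, map_mul, add_mul, mul_assoc, add_assoc]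

variable {C}

/-- A derivation whose values on generators are attained is attained on all words. -/
theorem Attains.derivation {H : T.Word →* T.Word} (hH : ∀ w, C.hom (H w) = C.hom w) {σ : T.Gen → R}
    (hσ : ∀ z, C.Attains (H (T.letter z)) (T.letter z) (σ z))
    (w : T.Word) : C.Attains (H w) w (C.derivation σ w) := by
  induction w using word_induction with
  | one =>
    rw [derivation_one, map_one]
    exact Attains.refl 1
  | cons z w ih =>
    -- The path is H(z)H(w) → z H(w) → z w; its first part has right context H(w), which has the
    -- same image as w.
    rw [derivation_of_mul, map_mul, ← hH w]
    exact ((hσ z).mul_right (H w)).trans (ih.mul_left _)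

/-- If the presented monoid is of finite derivation type and each difference of derivatives of
parallel 2-cells lies in some term of an increasing sequence of right ideals, then they all lie
in the same term. -/
theorem exists_forall_fox_sub_mem [Finite T.Rel] (h : Monoid.IsOfFiniteDerivationType T.Presented)
    (J : ℕ → AddSubgroup R) (hmono : Monotone J) (hJ : ∀ n, ∀ a ∈ J n, ∀ r, a * r ∈ J n)
    (hK : ∀ {u v : T.Word} (f g : T.TwoCell u v), ∃ n, C.fox f - C.fox g ∈ J n) :
    ∃ n, ∀ {u v : T.Word} (f g : T.TwoCell u v), C.fox f - C.fox g ∈ J n := by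
  obtain ⟨S, ⟨e⟩, -, Γ, hfin, hΓ⟩ := h
  have hK' : ∀ {u v : T.Word} {d d' : R}, C.Attains u v d → C.Attains u v d' →
      ∃ n, d - d' ∈ J n := by
    rintro u v _ _ ⟨f, rfl⟩ ⟨g, rfl⟩
    exact hK f g
  obtain ⟨F, hF⟩ := exists_word_lift (e.toMonoidHom.comp S.proj)
  obtain ⟨G, hG⟩ := exists_word_lift (e.symm.toMonoidHom.comp T.proj)
  have hFG : ∀ w, T.proj (F (G w)) = T.proj w := fun w => by
    rw [hF]
    change e (S.proj (G w)) = _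
    rw [hG]
    exact e.apply_symm_apply _
  have hFG' : ∀ w, C.hom (F (G w)) = C.hom w := fun w => C.hom_eq_of_proj_eq (hFG w)
  have hFrel : ∀ α, T.proj (F (S.lhs α)) = T.proj (F (S.rhs α)) := fun α => by
    rw [hF, hF]
    exact congrArg e (proj_lhs α)
  have hGrel : ∀ α, S.proj (G (T.lhs α)) = S.proj (G (T.rhs α)) := fun α => by
    rw [hG, hG]
    exact congrArg e.symm (proj_lhs α)
  let φ := fun α => (nonempty_twoCell (hFrel α)).some
  let ψ := fun α => (nonempty_twoCell (hGrel α)).some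
  let C₁ : S.FoxData R := ⟨C.hom.comp F, fun α => C.hom_eq_of_proj_eq (hFrel α), fun α => C.fox (φ α)⟩
  -- Derivative of a 2-cell of `T` carried to `S` by `G` and back by `F`. The round trip fixes
  -- classes in the monoid, so the representation is still `C.hom`.
  let C₂ : T.FoxData R := ⟨C.hom, C.hom_lhs, fun α => C₁.fox (ψ α)⟩
  have liftF : ∀ {u v : S.Word} (f : S.TwoCell u v), C.Attains (F u) (F v) (C₁.fox f) := fun f =>
    Attains.map F (fun _ => rfl) (fun α => ⟨φ α, rfl⟩) f
  have liftG : ∀ {u v : T.Word} (f : T.TwoCell u v), C₁.Attains (G u) (G v) (C₂.fox f) := fun f =>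
    Attains.map G hFG' (fun α => ⟨ψ α, rfl⟩) f
  let σ := fun z : T.Gen => C.fox (nonempty_twoCell (hFG (T.letter z))).some
  have hσ : ∀ w, C.Attains (F (G w)) w (C.derivation σ w) :=
    Attains.derivation (H := F.comp G) hFG' fun z => ⟨_, rfl⟩
  choose k hk using fun γ => hK' (liftF (Γ.src γ)) (liftF (Γ.tgt γ))
  choose l hl using fun α =>
    hK' ((liftF (ψ α)).trans (hσ (T.rhs α))) ((hσ (T.lhs α)).trans (Attains.rel α))
  -- There are finitely many 3-cells in `Γ` and finitely many relations in `T`, so a single index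
  -- serves all of them.
  obtain ⟨K, hKle⟩ := Finite.exists_le k
  obtain ⟨L, hLle⟩ := Finite.exists_le l
  have hΓJ := fun γ => hmono ((hKle γ).trans (le_max_left K L)) (hk γ)
  have hsq := fun α => hmono ((hLle α).trans (le_max_right K L)) (hl α)
  generalize max K L = n at hΓJ hsq
  -- Naturality modulo `J n` of the comparison 2-cells from F(G(w)) to w. The squares of the
  -- relations suffice, as a right context multiplies the defect on the right.
  have key : ∀ {u v : T.Word} (f : T.TwoCell u v),
      C₂.fox f + C.derivation σ v - C.derivation σ u - C.fox f ∈ J n := by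
    intro u v f
    induction f using twoCell_induction with
    | id u => simp
    | comp f g hf hg =>
      convert (J n).add_mem hf hg using 1
      rw [fox_comp, fox_comp]
      abel
    | inv f hf =>
      convert (J n).neg_mem hf using 1
      rw [fox_inv, fox_inv]
      abel
    | step s =>
      obtain ⟨l, α, r, rfl, rfl⟩ := s
      convert hJ n _ (hsq α) (C.hom r) using 1
      simp only [fox_step, derivation_mul, C.hom_lhs]
      change C₁.fox (ψ α) * C.hom r + _ - _ - _ = _
      noncomm_ring
  refine ⟨n, fun f g => ?_⟩
  obtain ⟨f', hf'⟩ := liftG f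
  obtain ⟨g', hg'⟩ := liftG g
  have h := C₁.fox_sub_mem_of_congr (hJ n) hΓJ (hΓ _ _ f' g')
  rw [hf', hg'] at h
  convert (J n).add_mem ((J n).sub_mem h (key f)) (key g) using 1
  abel

end FoxData

end TwoPolygraph

/-- `X` drops the first term of a sequence and `Y` inserts a 0 in front, so `Y * X` erases the first
term. -/
theorem exists_mul_eq_one_ne_one : ∃ X Y : Module.End ℤ (ℕ → ℤ), X * Y = 1 ∧ Y * X ≠ 1 := by
  let X : Module.End ℤ (ℕ → ℤ) := LinearMap.funLeft ℤ ℤ Nat.succ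
  let Y : Module.End ℤ (ℕ → ℤ) :=
    { toFun := fun f n => Nat.casesOn n 0 f
      map_add' := fun f g => by ext n; cases n <;> simp
      map_smul' := fun c f => by ext n; cases n <;> simp }
  refine ⟨X, Y, LinearMap.ext fun f => rfl, fun h => ?_⟩
  have h' : (0 : ℤ) = 1 := congrFun (LinearMap.congr_fun h fun _ => 1) 0
  exact zero_ne_one h'

/-! ### The derivative counting α, and the parallel 2-cells that it separates -/

namespace SquierMonoid

open TwoPolygraph FoxData

/-- The letter `a`, as a word. -/
def a : squierPolygraph.Word := squierPolygraph.letter SquierGen.a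

/-- The letter `b`, as a word. -/
def b : squierPolygraph.Word := squierPolygraph.letter SquierGen.b

/-- The letter `t`, as a word. -/
def t : squierPolygraph.Word := squierPolygraph.letter SquierGen.t

/-- The letter `x`, as a word. -/
def x : squierPolygraph.Word := squierPolygraph.letter SquierGen.x

/-- The letter `y`, as a word. -/
def y : squierPolygraph.Word := squierPolygraph.letter SquierGen.y

variable {R : Type*} [Ring R] {X Y : R}

variable (X Y) in
/-- The images of the letters under the representation `x ↦ X`, `y ↦ Y`, `a, b, t ↦ 1`. -/
def letterVal : SquierGen → R
  | .x => X
  | .y => Y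
  | _ => 1

variable (X Y) in
/-- The representation `x ↦ X`, `y ↦ Y`, `a, b, t ↦ 1` of words. -/
def rep : squierPolygraph.Word →* R :=
  (FreeMonoid.lift (letterVal X Y) : FreeMonoid SquierGen →* R)

theorem rep_letter (z : SquierGen) : rep X Y (squierPolygraph.letter z) = letterVal X Y z :=
  FreeMonoid.lift_eval_of _ z

@[simp] theorem rep_a : rep X Y a = 1 := rep_letter _
@[simp] theorem rep_b : rep X Y b = 1 := rep_letter _
@[simp] theorem rep_t : rep X Y t = 1 := rep_letter _
@[simp] theorem rep_x : rep X Y x = X := rep_letter _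
@[simp] theorem rep_y : rep X Y y = Y := rep_letter _

/-- A property of pairs of words holds for the boundaries of all relations of Squier's monoid if it
holds for each of the five. -/
theorem rel_cases {P : squierPolygraph.Word → squierPolygraph.Word → Prop}
    (hα : P (a * b) 1) (hβ : P (x * a) (a * t * x)) (hγ : P (x * t) (t * x))
    (hδ : P (x * b) (b * x)) (hε : P (x * y) 1) (ρ : squierPolygraph.Rel) :
    P (squierPolygraph.lhs ρ) (squierPolygraph.rhs ρ) :=
  match ρ with
  | .α => hα
  | .β => hβ
  | .γ => hγ
  | .δ => hδ
  | .ε => hε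

/-- The derivative that counts the occurrences of `α`, each with its right context. -/
def foxAlpha (h : X * Y = 1) : squierPolygraph.FoxData R where
  hom := rep X Y
  hom_lhs := rel_cases (P := fun u v => rep X Y u = rep X Y v) (by simp) (by simp) (by simp)
    (by simp) (by simp [h])
  val
    | .α => 1
    | _ => 0

section Derivatives

variable {h : X * Y = 1}

theorem attains_of_eq {u v u' v' : squierPolygraph.Word} {d d' : R}
    (k : (foxAlpha h).Attains u v d) (hu : u = u') (hv : v = v') (hd : d = d') :
    (foxAlpha h).Attains u' v' d' := by
  subst hu hv hd
  exact k

theorem attains_alpha : (foxAlpha h).Attains (a * b) 1 1 :=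
  Attains.rel (C := foxAlpha h) SquierRel.α
theorem attains_beta : (foxAlpha h).Attains (x * a) (a * t * x) 0 :=
  Attains.rel (C := foxAlpha h) SquierRel.β
theorem attains_gamma : (foxAlpha h).Attains (x * t) (t * x) 0 :=
  Attains.rel (C := foxAlpha h) SquierRel.γ
theorem attains_delta : (foxAlpha h).Attains (x * b) (b * x) 0 :=
  Attains.rel (C := foxAlpha h) SquierRel.δ
theorem attains_epsilon : (foxAlpha h).Attains (x * y) 1 0 :=
  Attains.rel (C := foxAlpha h) SquierRel.ε

theorem attains_x_t_pow (n : ℕ) : (foxAlpha h).Attains (x * t ^ n) (t ^ n * x) 0 := by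
  induction n with
  | zero => simpa using Attains.refl (C := foxAlpha h) x
  | succ n ih =>
    refine attains_of_eq ((attains_gamma.mul_right (t ^ n)).trans
      (attains_of_eq (ih.mul_left t) (mul_assoc _ _ _).symm rfl rfl)) ?_ ?_ ?_ <;>
    simp [pow_succ', mul_assoc]

theorem attains_x_a_t_pow_b (n : ℕ) :
    (foxAlpha h).Attains (x * (a * t ^ n * b)) (a * t ^ (n + 1) * b * x) 0 := by
  have h₁ := (attains_beta (h := h)).mul_right (t ^ n * b)
  have h₂ := (attains_x_t_pow (h := h) n).whisker (a * t) b
  have h₃ := (attains_delta (h := h)).mul_left (a * t * t ^ n)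
  refine attains_of_eq (h₁.trans (attains_of_eq (h₂.trans (attains_of_eq h₃ ?_ rfl rfl))
    ?_ rfl rfl)) ?_ ?_ ?_ <;>
  simp [pow_succ', mul_assoc]

theorem attains_a_t_pow_b_x_of {n : ℕ} {d : R} (k : (foxAlpha h).Attains (a * t ^ n * b) 1 d) :
    (foxAlpha h).Attains (a * t ^ (n + 1) * b * x) x d := by
  refine attains_of_eq ((attains_x_a_t_pow_b n).symm.trans (k.mul_left x)) ?_ ?_ ?_ <;> simp

theorem attains_a_t_pow_b (n : ℕ) : (foxAlpha h).Attains (a * t ^ n * b) 1 (Y ^ n) := by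
  induction n with
  | zero => simpa using attains_alpha (h := h)
  | succ n ih =>
    -- Insert xy on the right, turn a tⁿ⁺¹ b x y into x a tⁿ b y, reduce a tⁿ b, then remove xy. The
    -- only α's occur before the final y, whence one more factor Y.
    refine attains_of_eq ((attains_epsilon.symm.mul_left (a * t ^ (n + 1) * b)).trans
      (attains_of_eq (((attains_a_t_pow_b_x_of ih).mul_right y).trans attains_epsilon)
        (mul_assoc _ _ _) rfl rfl)) (mul_one _) rfl ?_
    change -0 + (Y ^ n * rep X Y y + 0) = _
    simp [pow_succ]

theorem attains_a_t_pow_b_x (n : ℕ) :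
    (foxAlpha h).Attains (a * t ^ (n + 1) * b * x) x (Y ^ n) :=
  attains_a_t_pow_b_x_of (attains_a_t_pow_b n)

theorem attains_a_t_pow_b_x' (n : ℕ) :
    (foxAlpha h).Attains (a * t ^ (n + 1) * b * x) x (Y ^ (n + 1) * X) := by
  refine attains_of_eq ((attains_a_t_pow_b (h := h) (n + 1)).mul_right x) rfl (one_mul _) ?_
  change _ * rep X Y x = _
  simp

end Derivatives

/-! ### The filtration by X-torsion -/

/-- The right ideals annihilated by the powers of `X`. -/
def torsion (X : R) (n : ℕ) : AddSubgroup R := (AddMonoidHom.mulLeft (X ^ n)).ker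

theorem mem_torsion {n : ℕ} {r : R} : r ∈ torsion X n ↔ X ^ n * r = 0 := Iff.rfl

theorem torsion_mono : Monotone (torsion X) := by
  intro m n hmn r hr
  obtain ⟨k, rfl⟩ := Nat.exists_eq_add_of_le' hmn
  rw [mem_torsion] at hr ⊢
  rw [pow_add, mul_assoc, hr, mul_zero]

theorem mul_mem_torsion (n : ℕ) (r : R) (hr : r ∈ torsion X n) (s : R) : r * s ∈ torsion X n := by
  rw [mem_torsion] at hr ⊢
  rw [← mul_assoc, hr, zero_mul]

/-- The elements annihilated by some power of `X`. -/
def allTorsion (X : R) : AddSubgroup R := ⨆ n, torsion X n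

theorem mem_allTorsion {r : R} : r ∈ allTorsion X ↔ ∃ n, X ^ n * r = 0 :=
  AddSubgroup.mem_iSup_of_directed torsion_mono.directed_le

/-! ### A potential for the derivative modulo torsion -/

/-- A stack machine on which Squier's monoid acts up to translations of `acc`. Besides the
accumulated derivative and the number of `x` minus the number of `y`, it stores a word
`t ^ exp * z₁ * t ^ k₁ * z₂ * t ^ k₂ ⋯`, where `zᵢ` is `b` or `a` according to the Boolean. -/
@[ext] structure State (R : Type*) where
  /-- The accumulated derivative. -/
  acc : R
  /-- The number of `x` minus the number of `y`. -/
  deg : ℤ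
  /-- The exponent of the initial power of `t`. -/
  exp : ℤ
  /-- The letters `a` and `b`, each with the exponent of the power of `t` that follows it. -/
  stack : List (Bool × ℤ)

/-- Adds `m` to the exponents of `t` after the letters `a`. -/
def shift (m : ℤ) (p : Bool × ℤ) : Bool × ℤ := if p.1 then p else (p.1, p.2 + m)

variable (X Y) in
/-- The `k`-th power of `X`, where `Y` stands for the inverse of `X`. -/
def intPow (k : ℤ) : R := Y ^ (-k).toNat * X ^ k.toNat

variable (X Y) in
/-- The action of the letters on states. -/
def act : SquierGen → State R → State R
  -- Here a tⁿ b is erased in a right context of degree d. Its reduction has derivative Yⁿ, so the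
  -- contribution is Yⁿ times Xᵈ, of degree d - n.
  | .a, ⟨r, d, n, (true, k) :: L⟩ => ⟨r + intPow X Y (d - n), d, k, L⟩
  | .a, ⟨r, d, n, L⟩ => ⟨r, d, 0, (false, n) :: L⟩
  | .b, ⟨r, d, n, L⟩ => ⟨r, d, 0, (true, n) :: L⟩
  | .t, ⟨r, d, n, L⟩ => ⟨r, d, n + 1, L⟩
  -- Moving x to the right end leaves one more t after each a. The letter y undoes this, so
  -- exponents may become negative.
  | .x, ⟨r, d, n, L⟩ => ⟨r, d + 1, n, L.map (shift 1)⟩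
  | .y, ⟨r, d, n, L⟩ => ⟨r, d - 1, n, L.map (shift (-1))⟩

/-- Adds `e` to the accumulated derivative. -/
def translate (e : R) (s : State R) : State R := { s with acc := s.acc + e }

/-- No transition reads `acc`, so a left context does not alter a contribution already made, just as
for the derivative. -/
theorem act_translate (z : SquierGen) (e : R) (s : State R) :
    act X Y z (translate e s) = translate e (act X Y z s) := by
  obtain ⟨r, d, n, L⟩ := s
  rcases z <;> rcases L with _ | ⟨⟨_ | _, k⟩, L⟩ <;> simp [act, translate, add_right_comm]

variable (X Y) in
/-- The action of words on states. -/
def run (w : squierPolygraph.Word) (s : State R) : State R :=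
  List.foldr (act X Y) s (FreeMonoid.toList w)

theorem run_mul (u v : squierPolygraph.Word) (s : State R) :
    run X Y (u * v) s = run X Y u (run X Y v s) :=
  List.foldr_append

@[simp] theorem run_one (s : State R) : run X Y 1 s = s := rfl

theorem run_letter (z : SquierGen) (s : State R) :
    run X Y (squierPolygraph.letter z) s = act X Y z s := rfl

theorem run_translate (w : squierPolygraph.Word) (e : R) (s : State R) :
    run X Y w (translate e s) = translate e (run X Y w s) := by
  induction w using word_induction with
  | one => simp
  | cons z w ih =>
    rw [run_mul, run_mul, ih]
    exact act_translate z e _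

@[simp] theorem shift_shift_neg (p : Bool × ℤ) : shift 1 (shift (-1) p) = p := by
  obtain ⟨_ | _, k⟩ := p <;> simp [shift]

/-- Only α contributes. For β in front of a b, passing x raises both the degree and the exponent of
t by 1, so the emitted power, of degree d - n, is the same on both sides. -/
theorem run_lhs (h : X * Y = 1) (ρ : squierPolygraph.Rel) (s : State R) :
    run X Y (squierPolygraph.lhs ρ) s =
      translate ((foxAlpha h).val ρ * intPow X Y s.deg) (run X Y (squierPolygraph.rhs ρ) s) := by
  obtain ⟨r, d, n, L⟩ := s
  rcases ρ with _ | _ | _ | _ | _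
  · change run X Y (a * b) _ = translate (1 * _) (run X Y 1 _)
    simp only [run_mul, run_one, a, b, run_letter]
    simp [act, translate]
  · change run X Y (x * a) _ = translate (0 * _) (run X Y (a * t * x) _)
    simp only [run_mul, a, t, x, run_letter]
    rcases L with _ | ⟨⟨_ | _, k⟩, L⟩ <;> simp [act, translate, shift]
  · change run X Y (x * t) _ = translate (0 * _) (run X Y (t * x) _)
    simp only [run_mul, t, x, run_letter]
    simp [act, translate]
  · change run X Y (x * b) _ = translate (0 * _) (run X Y (b * x) _)
    simp only [run_mul, b, x, run_letter]
    simp [act, translate, shift]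
  · change run X Y (x * y) _ = translate (0 * _) (run X Y 1 _)
    simp only [run_mul, run_one, y, x, run_letter]
    simp [act, translate, Function.comp_def]

variable (X Y) in
/-- The state reached from the empty state. -/
def final (w : squierPolygraph.Word) : State R := run X Y w ⟨0, 0, 0, []⟩

theorem deg_act (z : SquierGen) (s : State R) :
    (act X Y z s).deg = s.deg + (match z with | .x => 1 | .y => -1 | _ => 0) := by
  obtain ⟨r, d, n, L⟩ := s
  rcases z <;> rcases L with _ | ⟨⟨_ | _, k⟩, L⟩ <;> simp [act, sub_eq_add_neg]

theorem pow_mul_intPow (h : X * Y = 1) (n : ℕ) (k : ℤ) (hnk : 0 ≤ n + k) :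
    X ^ n * intPow X Y k = X ^ (n + k).toNat := by
  unfold intPow
  obtain ⟨m, rfl | rfl⟩ := k.eq_nat_or_neg
  · rw [Int.toNat_neg_natCast, pow_zero, one_mul, Int.toNat_natCast, ← pow_add, ← Nat.cast_add,
      Int.toNat_natCast]
  · obtain ⟨j, rfl⟩ : ∃ j, n = j + m := ⟨n - m, by omega⟩
    rw [pow_add, mul_assoc, ← mul_assoc (X ^ m)]
    simp [pow_mul_pow_eq_one _ h]

/-- Behind a high enough power of X every Y cancels an X, so that only the degree of the word
remains. -/
theorem exists_forall_pow_mul_rep (h : X * Y = 1) (w : squierPolygraph.Word) :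
    ∃ N : ℕ, ∀ n : ℕ, N ≤ n → 0 ≤ n + (final X Y w).deg ∧
      X ^ n * rep X Y w = X ^ (n + (final X Y w).deg).toNat := by
  induction w using word_induction with
  | one => exact ⟨0, fun n _ => by simp [final]⟩
  | cons z w ih =>
    obtain ⟨N, hN⟩ := ih
    have hdeg : (final X Y (squierPolygraph.letter z * w)).deg = _ :=
      (congrArg State.deg ((run_mul _ _ _).trans (run_letter z _))).trans (deg_act z _)
    rw [hdeg, map_mul, rep_letter z]
    -- The letter y consumes one X, so the induction hypothesis is used at n - 1; for x it is used
    -- at n + 1.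
    refine ⟨N + 1, fun n hn => ?_⟩
    change 0 ≤ n + ((final X Y w).deg + _) ∧ _ = X ^ (n + ((final X Y w).deg + _)).toNat
    rcases z
    case x =>
      have := hN (n + 1) (by omega)
      rw [pow_succ, mul_assoc] at this
      push_cast at this
      simpa [letterVal, add_assoc, add_comm, add_left_comm] using this
    case y =>
      obtain ⟨m, rfl⟩ : ∃ m, n = m + 1 := ⟨n - 1, by omega⟩
      have := hN m (by omega)
      rw [pow_succ, letterVal, mul_assoc, ← mul_assoc X, h, one_mul]
      push_cast
      rwa [show (m : ℤ) + 1 + ((final X Y w).deg + -1) = m + (final X Y w).deg by ring]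
    all_goals simpa [letterVal] using hN n (by omega)

theorem rep_sub_intPow_mem (h : X * Y = 1) (w : squierPolygraph.Word) :
    rep X Y w - intPow X Y (final X Y w).deg ∈ allTorsion X := by
  obtain ⟨N, hN⟩ := exists_forall_pow_mul_rep h w
  obtain ⟨h₁, h₂⟩ := hN N le_rfl
  exact mem_allTorsion.2 ⟨N, by rw [mul_sub, h₂, pow_mul_intPow h _ _ h₁, sub_self]⟩

/-- A step α with right context r contributes the image of r to the derivative and the power of X of
degree `deg r` to the difference of accumulators; these agree modulo torsion. -/
theorem fox_add_acc_sub_acc_mem (h : X * Y = 1) {u v : squierPolygraph.Word}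
    (f : squierPolygraph.TwoCell u v) :
    (foxAlpha h).fox f + (final X Y v).acc - (final X Y u).acc ∈ allTorsion X := by
  induction f using twoCell_induction with
  | id u => simp
  | comp f g hf hg =>
    convert (allTorsion X).add_mem hf hg using 1
    rw [fox_comp]
    abel
  | inv f hf =>
    convert (allTorsion X).neg_mem hf using 1
    rw [fox_inv]
    abel
  | step s =>
    obtain ⟨l, ρ, r, rfl, rfl⟩ := s
    have hacc : (final X Y (l * squierPolygraph.lhs ρ * r)).acc =
        (final X Y (l * squierPolygraph.rhs ρ * r)).acc +
          (foxAlpha h).val ρ * intPow X Y (final X Y r).deg := by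
      simp only [final, run_mul, run_lhs h, run_translate]
      rfl
    rw [hacc, fox_step]
    have hr := rep_sub_intPow_mem h r
    rcases ρ with _ | _ | _ | _ | _
    · change 1 * rep X Y r + _ - (_ + 1 * _) ∈ _
      convert hr using 1
      noncomm_ring
    all_goals
      change 0 * rep X Y r + _ - (_ + 0 * _) ∈ _
      simp

theorem exists_fox_sub_mem_torsion (h : X * Y = 1) {u v : squierPolygraph.Word}
    (f g : squierPolygraph.TwoCell u v) :
    ∃ n, (foxAlpha h).fox f - (foxAlpha h).fox g ∈ torsion X n := by
  refine mem_allTorsion.1 ?_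
  convert (allTorsion X).sub_mem (fox_add_acc_sub_acc_mem h f) (fox_add_acc_sub_acc_mem h g) using 1
  abel

theorem mul_eq_one_of_forall_fox_sub_mem (h : X * Y = 1) {n : ℕ}
    (hn : ∀ {u v : squierPolygraph.Word} (f g : squierPolygraph.TwoCell u v),
      (foxAlpha h).fox f - (foxAlpha h).fox g ∈ torsion X n) : Y * X = 1 := by
  obtain ⟨f, hf⟩ := attains_a_t_pow_b_x (h := h) n
  obtain ⟨g, hg⟩ := attains_a_t_pow_b_x' (h := h) n
  have hfg := hn f g
  -- Since XⁿYⁿ = 1, multiplying Yⁿ - Yⁿ⁺¹X by Xⁿ leaves 1 - YX.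
  rw [hf, hg, mem_torsion, mul_sub, pow_succ, ← mul_assoc, ← mul_assoc, pow_mul_pow_eq_one _ h,
    one_mul] at hfg
  exact (sub_eq_zero.1 hfg).symm

end SquierMonoid

theorem proposition6p2p6 : ¬ Monoid.IsOfFiniteDerivationType SquierMonoid := by
  intro hM
  obtain ⟨X, Y, h, hne⟩ := exists_mul_eq_one_ne_one
  have : Finite squierPolygraph.Rel :=
    Finite.of_surjective (fun i : Fin 5 => (![.α, .β, .γ, .δ, .ε] : Fin 5 → SquierRel) i) <| by
      rintro (_ | _ | _ | _ | _)
      exacts [⟨0, rfl⟩, ⟨1, rfl⟩, ⟨2, rfl⟩, ⟨3, rfl⟩, ⟨4, rfl⟩]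
  obtain ⟨n, hn⟩ := (SquierMonoid.foxAlpha h).exists_forall_fox_sub_mem hM
    (SquierMonoid.torsion X) SquierMonoid.torsion_mono SquierMonoid.mul_mem_torsion
    (SquierMonoid.exists_fox_sub_mem_torsion h)
  exact hne (SquierMonoid.mul_eq_one_of_forall_fox_sub_mem h hn)
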